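/- Let $2=\{0,1\}$ and write $S(X)$ for the group of permutations of a finite set $X$. For $f\in S(2\times A)$ let $f\times 2\in S(2\times A\times 2)$ be the permutation $(x,a,y)\mapsto(f(x,a),y)$, and for $g\in S(A\times 2)$ let $2\times g\in S(2\times A\times 2)$ be the permutation $(x,a,y)\mapsto(x,g(a,y))$. Say that $\sigma\in S(2\times A\times 2)$ has even alternation depth $d$ if it can be written as a product $\sigma=\sigma_1\sigma_2\cdots\sigma_d$ of $d$ factors, where each $\sigma_i$ is either of the form $f\times 2$ for some even permutation $f\in S(2\times A)$ or of the form $2\times g$ for some even permutation $g\in S(A\times 2)$. Theorem. Let $A$ be a finite set of $3$ or more elements. Then every even permutation $\sigma\in S(2\times A\times 2)$ has even alternation depth $13$. -/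

import Mathlib

section AlternationDepth

variable {A : Type*}

/-- The permutation `f × 2` of `2 × A × 2`, i.e. `(x, a, y) ↦ (f (x, a), y)` (up to bracketing). -/
def permTimesTwo (f : Equiv.Perm (Fin 2 × A)) : Equiv.Perm (Fin 2 × A × Fin 2) :=
  (Equiv.prodAssoc (Fin 2) A (Fin 2)).permCongr (Equiv.prodCongr f (Equiv.refl (Fin 2)))

/-- The permutation `2 × g` of `2 × A × 2`, i.e. `(x, a, y) ↦ (x, g (a, y))`. -/
def twoTimesPerm (g : Equiv.Perm (A × Fin 2)) : Equiv.Perm (Fin 2 × A × Fin 2) :=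
  Equiv.prodCongr (Equiv.refl (Fin 2)) g

theorem permTimesTwo_apply (f : Equiv.Perm (Fin 2 × A)) (x : Fin 2) (a : A) (y : Fin 2) :
    permTimesTwo f (x, a, y) = ((f (x, a)).1, (f (x, a)).2, y) := rfl

theorem twoTimesPerm_apply (g : Equiv.Perm (A × Fin 2)) (x : Fin 2) (a : A) (y : Fin 2) :
    twoTimesPerm g (x, a, y) = (x, g (a, y)) := rfl

/-- `σ` has even alternation depth `d`: it is a product `σ₁ σ₂ ⋯ σ_d` of `d` factors, each of the
form `f × 2` with `f` an even permutation of `2 × A`, or `2 × g` with `g` an even permutation of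
`A × 2`. -/
def HasEvenAlternationDepth [Fintype A] [DecidableEq A]
    (σ : Equiv.Perm (Fin 2 × A × Fin 2)) (d : ℕ) : Prop :=
  ∃ l : List (Equiv.Perm (Fin 2 × A × Fin 2)), l.length = d ∧ l.prod = σ ∧
    ∀ τ ∈ l,
      (∃ f : Equiv.Perm (Fin 2 × A), Equiv.Perm.sign f = 1 ∧ τ = permTimesTwo f) ∨
      (∃ g : Equiv.Perm (A × Fin 2), Equiv.Perm.sign g = 1 ∧ τ = twoTimesPerm g)

end AlternationDepth

/-! Four factors straighten `σ` and nine finish the job.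

Straightening (`exists_mul_eq_prodCongrRight`): colour each point by the first coordinate of its
image under `σ⁻¹`. A factor `2 × g` rearranges the vertical pairs of colours and a factor `f × 2`
the horizontal ones, so only the frequencies of colour pairs matter. Three factors turn any balanced
colouring into one fixed pivot colouring, and a fourth turns that into the first coordinate. What
remains acts on each layer `x = 0, 1` separately, by permutations of equal sign; if both are odd, a
correction absorbed into an existing factor makes both even.

Finishing (`hasEvenAlternationDepth_prodCongrRight`): after `2 × γ 0` is split off, an even
permutation `(γ 0)⁻¹ * γ 1` is left on layer `1` alone. Conjugates of maps `τ × 2` are cheap there: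
`τ` on layer `1` has the form `f × 2`, and the conjugators act on both layers and cancel on layer
`0`. Four conjugates suffice. A nontrivial even permutation is a product of two cycles each missing
one point (`exists_mul_fullCycle_of_sign_eq_one`), and each such cycle is a commutator of some `τ ×
2`, or a slight variant of one, hence a product of two conjugates
(`exists_isLift_mul_isFullCycleOn`). -/

section FullCycles

/-! ### Factoring permutations into two long cycles. -/

variable {B : Type*} [DecidableEq B]

/-- `c` permutes the points of `s` in a single cycle and fixes all other points. -/
def IsFullCycleOn (s : Finset B) (c : Equiv.Perm B) : Prop :=
  ∃ l : List B, l.Nodup ∧ l.toFinset = s ∧ l.formPerm = c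

namespace IsFullCycleOn

variable {s : Finset B} {c : Equiv.Perm B}

theorem exists_cons (h : IsFullCycleOn s c) {x : B} (hx : x ∈ s) :
    ∃ l : List B, (x :: l).Nodup ∧ (x :: l).toFinset = s ∧ (x :: l).formPerm = c := by
  obtain ⟨l, hl, rfl, rfl⟩ := h
  obtain ⟨l₁, l₂, rfl⟩ := List.append_of_mem (List.mem_toFinset.1 hx)
  have hrot : (l₁ ++ x :: l₂) ~r (x :: (l₂ ++ l₁)) := by
    simpa using List.isRotated_append (l := l₁) (l' := x :: l₂)
  refine ⟨l₂ ++ l₁, hrot.nodup_iff.1 hl, ?_, (List.formPerm_eq_of_isRotated hl hrot).symm⟩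
  ext y
  simp only [List.mem_toFinset, hrot.mem_iff]

theorem swap_mul (h : IsFullCycleOn s c) {x p : B} (hx : x ∈ s) (hp : p ∉ s) :
    IsFullCycleOn (insert p s) (Equiv.swap p x * c) := by
  obtain ⟨l, hl, rfl, rfl⟩ := h.exists_cons hx
  refine ⟨p :: x :: l, List.nodup_cons.2 ⟨by simpa using hp, hl⟩, by simp, ?_⟩
  rw [List.formPerm_cons_cons]

theorem inv (h : IsFullCycleOn s c) : IsFullCycleOn s c⁻¹ := by
  obtain ⟨l, hl, rfl, rfl⟩ := h
  exact ⟨l.reverse, by simpa using hl, by simp, List.formPerm_reverse l⟩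

theorem apply_mem_iff (h : IsFullCycleOn s c) {x : B} : c x ∈ s ↔ x ∈ s := by
  obtain ⟨l, -, rfl, rfl⟩ := h
  simp

theorem apply_of_notMem (h : IsFullCycleOn s c) {x : B} (hx : x ∉ s) : c x = x := by
  obtain ⟨l, -, rfl, rfl⟩ := h
  exact List.formPerm_apply_of_notMem (by simpa using hx)

theorem apply_ne (h : IsFullCycleOn s c) (hs : 2 ≤ s.card) {x : B} (hx : x ∈ s) : c x ≠ x := by
  obtain ⟨l, hl, rfl, rfl⟩ := h
  rw [List.toFinset_card_of_nodup hl] at hs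
  exact (List.formPerm_apply_mem_ne_self_iff l hl x (by simpa using hx)).2 hs

theorem isCycle (h : IsFullCycleOn s c) (hs : 2 ≤ s.card) : c.IsCycle := by
  obtain ⟨l, hl, rfl, rfl⟩ := h
  rw [List.toFinset_card_of_nodup hl] at hs
  exact List.isCycle_formPerm hl hs

theorem support [Fintype B] (h : IsFullCycleOn s c) (hs : 2 ≤ s.card) : c.support = s := by
  ext x
  rw [Equiv.Perm.mem_support]
  exact ⟨fun hx => by_contra fun hxs => hx (h.apply_of_notMem hxs), fun hx => h.apply_ne hs hx⟩

theorem isConj [Fintype B] {t : Finset B} {d : Equiv.Perm B} (hc : IsFullCycleOn s c)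
    (hd : IsFullCycleOn t d) (hst : s.card = t.card) (hs : 2 ≤ s.card) : IsConj c d :=
  (hc.isCycle hs).isConj (hd.isCycle (hst ▸ hs)) (by rw [hc.support hs, hd.support (hst ▸ hs), hst])

end IsFullCycleOn

/-- Sharing one point, two cycles compose to a single cycle. -/
theorem formPerm_append_mul_formPerm_cons (l₁ l₂ : List B) (z : B) :
    (l₁ ++ [z]).formPerm * (z :: l₂).formPerm = (l₁ ++ z :: l₂).formPerm := by
  induction l₁ with
  | nil => simp
  | cons a l ih =>
    cases l with
    | nil => simp
    | cons b l =>
      simp only [List.cons_append, List.formPerm_cons_cons] at ih ⊢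
      rw [mul_assoc, ih]

/-- Inductive step of the factorisation. As `α` fixes `p`, moving `swap p y` rightwards past `α`
turns it into `swap p (α⁻¹ y)`, so each of the two transpositions inserts `p` into one of the two
cycles. -/
theorem exists_mul_eq_of_reduced {s : Finset B} {w p x y : B} {g : Equiv.Perm B} (hp : p ∈ s)
    (hpw : p ≠ w) (hx : x ∈ s) (hxp : x ≠ p) (hxw : x ≠ w) (hy : y ∈ s) (hyp : y ≠ p)
    (h : ∃ α c : Equiv.Perm B, IsFullCycleOn ((s.erase p).erase w) α ∧
      IsFullCycleOn (s.erase p) c ∧ Equiv.swap p y * Equiv.swap p x * g = α * c) :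
    ∃ α c : Equiv.Perm B, IsFullCycleOn (s.erase w) α ∧ IsFullCycleOn s c ∧ g = α * c := by
  obtain ⟨α, c, hα, hc, h⟩ := h
  have hpα : p ∉ (s.erase p).erase w := by simp
  have hαp : α⁻¹ p = p := hα.inv.apply_of_notMem hpα
  have hz : α⁻¹ y ∈ s.erase p := by
    by_cases hyw : y = w
    · rw [hα.inv.apply_of_notMem (by simp [hyw])]
      simp [hyp, hy]
    · exact Finset.mem_of_mem_erase (hα.inv.apply_mem_iff.2 (by simp [hyw, hyp, hy]))
  refine ⟨Equiv.swap p x * α, Equiv.swap p (α⁻¹ y) * c, ?_, ?_, ?_⟩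
  · have := hα.swap_mul (x := x) (p := p) (by simp [hxw, hxp, hx]) hpα
    rwa [Finset.erase_right_comm, Finset.insert_erase (by simp [hpw, hp])] at this
  · have := hc.swap_mul hz (Finset.notMem_erase p s)
    rwa [Finset.insert_erase hp] at this
  · have hs : Equiv.swap p (α⁻¹ y) = α⁻¹ * Equiv.swap p y * α := by
      simpa [hαp] using Equiv.swap_apply_apply α⁻¹ p y
    rw [hs]
    calc g = Equiv.swap p x * Equiv.swap p y * (Equiv.swap p y * Equiv.swap p x * g) := by
            simp [mul_assoc]
      _ = _ := by rw [h]; group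

/-- Induction on the size of `s`: two transpositions through a point `p` make it fixed, keep the
sign and keep `w` moved, so `p` can be dropped from `s`. -/
theorem exists_mul_fullCycle_of_sign_eq_neg_one [Fintype B] (n : ℕ) :
    ∀ (s : Finset B), s.card = n + 2 → ∀ w ∈ s, ∀ g : Equiv.Perm B, (∀ x ∉ s, g x = x) →
      g w ≠ w → Equiv.Perm.sign g = -1 →
      ∃ α c : Equiv.Perm B, IsFullCycleOn (s.erase w) α ∧ IsFullCycleOn s c ∧ g = α * c := by
  induction n with
  | zero =>
    intro s hs w hw g hg hgw _
    have hmem : ∀ x, g x ∈ s → x ∈ s := fun x hx => by_contra fun h => h (hg x h ▸ hx)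
    have hcard : (s.erase w).card = 1 := by rw [Finset.card_erase_of_mem hw, hs]
    obtain ⟨b, hb⟩ := Finset.card_eq_one.1 hcard
    have hsb : s = {w, b} := by rw [← Finset.insert_erase hw, hb]
    have hbw : b ≠ w := by
      have : b ∈ s.erase w := by simp [hb]
      exact (Finset.mem_erase.1 this).1
    have hmem' : ∀ x ∈ s, g x ∈ s := fun x hx => by_contra fun h => h (by rwa [g.injective (hg _ h)])
    have hgw' : g w = b := by
      have := hmem' w hw
      rw [hsb] at this
      simpa [hgw] using this
    have hgb : g b = w := by
      have := hmem' b (by simp [hsb])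
      rw [hsb] at this
      have hne : g b ≠ b := fun h => hbw (g.injective (h.trans hgw'.symm))
      simpa [hne] using this
    refine ⟨1, g, ⟨[b], by simp, by simp [hb], by simp⟩, ⟨[w, b], by simp [hbw.symm], by simp [hsb], ?_⟩,
      by simp⟩
    ext x
    rw [List.formPerm_pair]
    by_cases hx : x = w
    · simp [hx, hgw']
    by_cases hx' : x = b
    · simp [hx', hgb]
    · rw [Equiv.swap_apply_of_ne_of_ne hx hx', hg x (by simp [hsb, hx, hx'])]
  | succ n ih =>
    intro s hs w hw g hg hgw hsign
    have hmem' : ∀ x ∈ s, g x ∈ s := fun x hx => by_contra fun h => h (by rwa [g.injective (hg _ h)])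
    suffices H : ∃ p x y, p ∈ s ∧ p ≠ w ∧ x ∈ s ∧ x ≠ p ∧ x ≠ w ∧ y ∈ s ∧ y ≠ p ∧
        (Equiv.swap p y * Equiv.swap p x * g) p = p ∧
        (Equiv.swap p y * Equiv.swap p x * g) w ≠ w by
      obtain ⟨p, x, y, hp, hpw, hx, hxp, hxw, hy, hyp, h₁, h₂⟩ := H
      refine exists_mul_eq_of_reduced hp hpw hx hxp hxw hy hyp
        (ih _ (by rw [Finset.card_erase_of_mem hp, hs]; rfl) w (by simp [hpw.symm, hw]) _ ?_ h₂ ?_)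
      · intro z hz
        by_cases hzp : z = p
        · rw [hzp, h₁]
        have hzs : z ∉ s := fun h => hz (by simp [hzp, h])
        have hzx : z ≠ x := fun h => hzs (h ▸ hx)
        have hzy : z ≠ y := fun h => hzs (h ▸ hy)
        simp [hg z hzs, Equiv.swap_apply_of_ne_of_ne, hzp, hzx, hzy]
      · rw [map_mul, map_mul, Equiv.Perm.sign_swap hyp.symm, Equiv.Perm.sign_swap hxp.symm, hsign]
        rfl
    by_cases hfix : ∃ p ∈ s, g p = p
    · obtain ⟨p, hp, hgp⟩ := hfix
      have hpw : p ≠ w := fun h => hgw (h ▸ hgp)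
      obtain ⟨x, hx⟩ : ((s.erase p).erase w).Nonempty := by
        rw [← Finset.card_pos, Finset.card_erase_of_mem (by simp [hpw.symm, hw]),
          Finset.card_erase_of_mem hp]
        omega
      simp only [Finset.mem_erase] at hx
      -- With `y = x` the two transpositions cancel: `p` is already fixed.
      refine ⟨p, x, x, hp, hpw, hx.2.2, hx.2.1, hx.1, hx.2.2, hx.2.1, ?_, ?_⟩ <;>
        simp [hgp, hgw]
    · push Not at hfix
      -- Three points without a fixed one would make `g` a 3-cycle, which is even. The fourth point
      -- leaves room for `x` outside `{p, w, g p}`.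
      have hn : 4 ≤ s.card := by
        by_contra hlt
        have hsupp : g.support = s := by
          ext z
          rw [Equiv.Perm.mem_support]
          exact ⟨fun hz => by_contra fun h => hz (hg z h), fun hz => hfix z hz⟩
        have h3 := (card_support_eq_three_iff.1 (show g.support.card = 3 by rw [hsupp]; omega)).sign
        rw [h3] at hsign
        exact absurd hsign (by decide)
      obtain ⟨p, hp⟩ : ((s.erase w).erase (g⁻¹ w)).Nonempty := by
        rw [← Finset.card_pos]
        have h1 := Finset.pred_card_le_card_erase (s := s.erase w) (a := g⁻¹ w)
        rw [Finset.card_erase_of_mem hw] at h1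
        omega
      simp only [Finset.mem_erase] at hp
      obtain ⟨hp₁, hpw, hp⟩ := hp
      have hgpw : g p ≠ w := fun h => hp₁ (by rw [← h]; simp)
      obtain ⟨x, hx⟩ : (((s.erase p).erase w).erase (g p)).Nonempty := by
        rw [← Finset.card_pos]
        have h1 := Finset.pred_card_le_card_erase (s := (s.erase p).erase w) (a := g p)
        rw [Finset.card_erase_of_mem (by simp [hpw.symm, hw]), Finset.card_erase_of_mem hp] at h1
        omega
      simp only [Finset.mem_erase] at hx
      obtain ⟨hxg, hxw, hxp, hx⟩ := hx
      have hgpp := hfix p hp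
      refine ⟨p, x, g p, hp, hpw, hx, hxp, hxw, hmem' p hp, hgpp, ?_, ?_⟩
      · simp [Equiv.swap_apply_of_ne_of_ne hgpp hxg.symm]
      · intro h
        have : g w = (Equiv.swap p x) ((Equiv.swap p (g p)) w) := by
          nth_rewrite 2 [← h]
          simp
        rw [Equiv.swap_apply_of_ne_of_ne hpw.symm hgpw.symm,
          Equiv.swap_apply_of_ne_of_ne hpw.symm hxw.symm] at this
        exact hgw this

/-- A nontrivial even permutation is a product of two cycles, each missing one point. -/
theorem exists_mul_fullCycle_of_sign_eq_one [Fintype B] {g : Equiv.Perm B} (hg : g ≠ 1)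
    (hsign : Equiv.Perm.sign g = 1) :
    ∃ (u w : B) (α c : Equiv.Perm B), IsFullCycleOn (Finset.univ.erase u) α ∧
      IsFullCycleOn (Finset.univ.erase w) c ∧ g = α * c := by
  obtain ⟨w, hw⟩ : ∃ w, g w ≠ w := by
    by_contra! h
    exact hg (Equiv.ext h)
  set g' := Equiv.swap w (g w) * g with hg'
  have hsign' : Equiv.Perm.sign g' = -1 := by
    rw [hg', map_mul, Equiv.Perm.sign_swap hw.symm, hsign]; rfl
  have hg'w : g' w = w := by simp [hg']
  -- Requiring `u ≠ g w` keeps `g w` on the cycle `α` that misses `u` and `w`, so that `swap w (g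
  -- w)` attaches `w` to it.
  obtain ⟨u, hu, hug⟩ : ∃ u ∈ g'.support, u ≠ g w := by
    have hne : g' ≠ 1 := fun h => by rw [h] at hsign'; exact absurd hsign' (by simp)
    exact Finset.exists_mem_ne (Equiv.Perm.one_lt_card_support_of_ne_one hne) _
  rw [Equiv.Perm.mem_support] at hu
  have huw : u ≠ w := fun h => hu (h ▸ hg'w)
  have hcard : 2 ≤ (Finset.univ.erase w : Finset B).card :=
    Finset.one_lt_card.2 ⟨u, by simp [huw], g w, by simp [hw], hug⟩
  obtain ⟨α, c, hα, hc, h⟩ := exists_mul_fullCycle_of_sign_eq_neg_one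
    ((Finset.univ.erase w : Finset B).card - 2) (Finset.univ.erase w) (by omega) u (by simp [huw]) g'
    (by simp [hg'w]) hu hsign'
  refine ⟨u, w, Equiv.swap w (g w) * α, c, ?_, hc, ?_⟩
  · have := hα.swap_mul (x := g w) (p := w) (by simp [hug.symm, hw]) (by simp)
    rwa [Finset.erase_right_comm, Finset.insert_erase (by simp [huw.symm])] at this
  · rw [mul_assoc, ← h, hg']; simp

end FullCycles

/-! ### Long cycles on `A × 2` as products of two conjugates of maps `τ × 2`. -/

section Lifts

variable {B : Type*} [DecidableEq B]

theorem conj_formPerm (f : Equiv.Perm B) (l : List B) :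
    f * l.formPerm * f⁻¹ = (l.map f).formPerm := by
  induction l with
  | nil => simp
  | cons a l ih =>
    cases l with
    | nil => simp
    | cons b l =>
      simp only [List.map_cons, List.formPerm_cons_cons] at ih ⊢
      rw [← ih, Equiv.swap_apply_apply]
      group

namespace IsFullCycleOn

variable {s t : Finset B} {c d : Equiv.Perm B}

theorem conj (h : IsFullCycleOn s c) (f : Equiv.Perm B) :
    IsFullCycleOn (s.image f) (f * c * f⁻¹) := by
  obtain ⟨l, hl, rfl, rfl⟩ := h
  exact ⟨l.map f, hl.map f.injective, by ext; simp, (conj_formPerm f l).symm⟩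

theorem mul_of_inter_eq_singleton (hc : IsFullCycleOn s c) (hd : IsFullCycleOn t d) {z : B}
    (hz : s ∩ t = {z}) : IsFullCycleOn (s ∪ t) (c * d) := by
  have hzm : z ∈ s ∩ t := by simp [hz]
  obtain ⟨l₁, hl₁, rfl, rfl⟩ := hc.exists_cons (Finset.mem_inter.1 hzm).1
  obtain ⟨l₂, hl₂, rfl, rfl⟩ := hd.exists_cons (Finset.mem_inter.1 hzm).2
  have hrot : (z :: l₁) ~r (l₁ ++ [z]) := by
    simpa using List.isRotated_append (l := [z]) (l' := l₁)
  refine ⟨l₁ ++ z :: l₂, ?_, by ext; simp, ?_⟩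
  · rw [List.nodup_cons] at hl₁
    refine List.nodup_append.2 ⟨hl₁.2, hl₂, ?_⟩
    rintro a ha b hb rfl
    have : a ∈ (z :: l₁).toFinset ∩ (z :: l₂).toFinset := by
      simp only [Finset.mem_inter, List.mem_toFinset]
      exact ⟨List.mem_cons_of_mem _ ha, hb⟩
    rw [hz, Finset.mem_singleton] at this
    exact hl₁.1 (this ▸ ha)
  · rw [List.formPerm_eq_of_isRotated hl₁ hrot, formPerm_append_mul_formPerm_cons]

end IsFullCycleOn

theorem exists_isFullCycleOn (s : Finset B) : ∃ c, IsFullCycleOn s c :=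
  ⟨_, s.toList, s.nodup_toList, s.toList_toFinset, rfl⟩

variable {A : Type*}

/-- The permutation `τ × 2` of `A × 2`. -/
def prodTwo (τ : Equiv.Perm A) : Equiv.Perm (A × Fin 2) :=
  Equiv.prodCongr τ (Equiv.refl (Fin 2))

@[simp]
theorem prodTwo_apply (τ : Equiv.Perm A) (b : A × Fin 2) : prodTwo τ b = (τ b.1, b.2) := rfl

theorem prodTwo_inv (τ : Equiv.Perm A) : (prodTwo τ)⁻¹ = prodTwo τ⁻¹ := rfl

@[simp]
theorem prodTwo_one : prodTwo (1 : Equiv.Perm A) = 1 := rfl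

variable [DecidableEq A]

/-- `d` is conjugate to `τ × 2` for an even permutation `τ` such that `τ × 2` visibly commutes
with an odd permutation. -/
def IsLift [Fintype A] (d : Equiv.Perm (A × Fin 2)) : Prop :=
  ∃ (τ : Equiv.Perm A) (h : Equiv.Perm (A × Fin 2)), Equiv.Perm.sign τ = 1 ∧
    (Odd (Fintype.card A) ∨ ∃ e, τ e = e) ∧ d = h * prodTwo τ * h⁻¹

theorem IsLift.one [Fintype A] [Nonempty A] : IsLift (1 : Equiv.Perm (A × Fin 2)) :=
  ⟨1, 1, by simp, Or.inr ⟨Classical.arbitrary A, rfl⟩, by simp⟩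

theorem IsLift.conj [Fintype A] {d : Equiv.Perm (A × Fin 2)} (hd : IsLift d)
    (k : Equiv.Perm (A × Fin 2)) : IsLift (k * d * k⁻¹) := by
  obtain ⟨τ, h, hτ, hc, rfl⟩ := hd
  exact ⟨τ, k * h, hτ, hc, by group⟩

theorem IsLift.inv [Fintype A] {d : Equiv.Perm (A × Fin 2)} (hd : IsLift d) : IsLift d⁻¹ := by
  obtain ⟨τ, h, hτ, hc, rfl⟩ := hd
  refine ⟨τ⁻¹, h, by simpa using hτ, hc.imp_right ?_, by rw [← prodTwo_inv]; group⟩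
  rintro ⟨e, he⟩
  exact ⟨e, by rw [Equiv.Perm.inv_eq_iff_eq, he]⟩

/-- Flipping the second coordinate everywhere is a product of `|A|` transpositions, hence odd for
odd `|A|`; otherwise the flip over a fixed point of `τ` serves. This allows the conjugator of a lift
to be chosen even. -/
theorem exists_odd_commute_prodTwo [Fintype A] {τ : Equiv.Perm A}
    (h : Odd (Fintype.card A) ∨ ∃ e, τ e = e) :
    ∃ k : Equiv.Perm (A × Fin 2), Equiv.Perm.sign k = -1 ∧ k * prodTwo τ = prodTwo τ * k := by
  rcases h with h | ⟨e, he⟩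
  · refine ⟨Equiv.prodCongrRight fun _ => Equiv.swap 0 1, ?_, ?_⟩
    · rw [Equiv.Perm.sign_prodCongrRight]
      simp [h.neg_one_pow]
    · ext ⟨a, y⟩ <;> simp
  · refine ⟨Equiv.swap (e, 0) (e, 1), Equiv.Perm.sign_swap (by simp), ?_⟩
    have := Equiv.swap_apply_apply (prodTwo τ) (e, 0) (e, 1)
    simp only [prodTwo_apply, he] at this
    rw [eq_mul_inv_iff_mul_eq] at this
    exact this

theorem IsLift.exists_even [Fintype A] {d : Equiv.Perm (A × Fin 2)} (hd : IsLift d) :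
    ∃ (τ : Equiv.Perm A) (h : Equiv.Perm (A × Fin 2)), Equiv.Perm.sign τ = 1 ∧
      Equiv.Perm.sign h = 1 ∧ d = h * prodTwo τ * h⁻¹ := by
  obtain ⟨τ, h, hτ, hc, rfl⟩ := hd
  rcases Int.units_eq_one_or (Equiv.Perm.sign h) with hh | hh
  · exact ⟨τ, h, hτ, hh, rfl⟩
  · obtain ⟨k, hk, hkτ⟩ := exists_odd_commute_prodTwo hc
    refine ⟨τ, h * k, hτ, by rw [map_mul, hh, hk]; rfl, ?_⟩
    rw [mul_assoc h k, hkτ]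
    group

/-- For a full cycle `s` on `{(a, 0)} ∪ O × 2`, its conjugate by `τ × 2` and `s⁻¹` are cycles whose
supports meet only in `(τ a, 0)`, so they merge into one cycle. Regrouped as `τ × 2` times a
conjugate of its inverse, the commutator is a product of two lifts. -/
theorem exists_commutator_isFullCycleOn [Fintype A] {τ : Equiv.Perm A} {O : Finset A} {a : A}
    (haO : a ∉ O) (hτa : τ a ∈ O) (haτ : a ∉ O.image τ) (hO : Disjoint O (O.image τ)) :
    ∃ s : Equiv.Perm (A × Fin 2), IsFullCycleOn
      (insert (a, 0) ((O ∪ O.image τ) ×ˢ Finset.univ))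
      (prodTwo τ * s * (prodTwo τ)⁻¹ * s⁻¹) := by
  set U : Finset (A × Fin 2) := insert (a, 0) (O ×ˢ Finset.univ) with hU
  obtain ⟨s, hs⟩ := exists_isFullCycleOn U
  have hαU : U.image (prodTwo τ) = insert (τ a, 0) (O.image τ ×ˢ Finset.univ) := by
    ext ⟨b, y⟩
    simp [hU, Prod.ext_iff]
  have hdisj : ∀ x ∈ O, x ∉ O.image τ := fun x hx hx' => Finset.disjoint_left.1 hO hx hx'
  have hne : τ a ≠ a := fun h => haO (h ▸ hτa)
  have hinter : U.image (prodTwo τ) ∩ U = {(τ a, 0)} := by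
    rw [hαU]
    ext ⟨b, y⟩
    simp only [hU, Finset.mem_inter, Finset.mem_insert, Finset.mem_product, Finset.mem_univ,
      and_true, Finset.mem_singleton, Prod.mk.injEq]
    constructor
    · rintro ⟨h | h, h' | h'⟩
      · exact h
      · exact h
      · exact absurd (h'.1 ▸ h) haτ
      · exact absurd h (hdisj b h')
    · rintro ⟨rfl, rfl⟩
      exact ⟨Or.inl ⟨rfl, rfl⟩, Or.inr hτa⟩
  refine ⟨s, ?_⟩
  have := (hs.conj (prodTwo τ)).mul_of_inter_eq_singleton hs.inv hinter
  convert this using 1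
  rw [hαU]
  ext ⟨b, y⟩
  simp only [hU, Finset.mem_union, Finset.mem_insert, Finset.mem_product, Finset.mem_univ,
      and_true, Prod.mk.injEq]
  constructor
  · rintro (h | h | h) <;> tauto
  · rintro ((⟨rfl, rfl⟩ | h) | h | h) <;> tauto

/-- A long odd cycle `τ`, with the set `O` of its points at odd distance from `a`. -/
theorem exists_odd_cycle_data [Fintype A] (j : ℕ) (hj : 1 ≤ j) (hA : 2 * j + 1 ≤ Fintype.card A) :
    ∃ (τ : Equiv.Perm A) (O : Finset A) (a : A), Equiv.Perm.sign τ = 1 ∧ O.card = j ∧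
      a ∉ O ∧ τ a ∈ O ∧ a ∉ O.image τ ∧ Disjoint O (O.image τ) ∧ τ⁻¹ a ∈ O.image τ ∧
      (2 * j + 1 < Fintype.card A → ∃ e, τ e = e) := by
  obtain ⟨ι⟩ := Function.Embedding.nonempty_of_card_le (α := Fin (2 * j + 1)) (β := A) (by simpa)
  set τ := (finRotate (2 * j + 1)).viaFintypeEmbedding ι with hτ
  have hap : ∀ i, τ (ι i) = ι (i + 1) := fun i => by
    rw [hτ, Equiv.Perm.viaFintypeEmbedding_apply_image, finRotate_apply]
  set b : ℕ → A := fun i => ι (Fin.ofNat (2 * j + 1) i) with hb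
  have hbinj : ∀ i k, i < 2 * j + 1 → k < 2 * j + 1 → b i = b k → i = k := by
    intro i k hi hk h
    have := congrArg Fin.val (ι.injective h)
    simpa [Fin.val_ofNat, Nat.mod_eq_of_lt hi, Nat.mod_eq_of_lt hk] using this
  have hbs : ∀ i, τ (b i) = b (i + 1) := by
    intro i
    simp only [hb, hap]
    congr 1
    ext
    simp [Fin.val_add]
  have hb0 : b (2 * j + 1) = b 0 := by
    simp only [hb]
    congr 1
    ext
    simp
  have hO : ∀ x, x ∈ (Finset.range j).image (fun i => b (2 * i + 1)) ↔ ∃ i < j, b (2 * i + 1) = x := by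
    simp
  have hτO : ∀ x, x ∈ ((Finset.range j).image (fun i => b (2 * i + 1))).image τ ↔
      ∃ i < j, b (2 * i + 2) = x := by
    simp [hbs]
  refine ⟨τ, (Finset.range j).image (fun i => b (2 * i + 1)), b 0, ?_, ?_, ?_, ?_, ?_, ?_, ?_, ?_⟩
  · rw [hτ, Equiv.Perm.viaFintypeEmbedding_sign, sign_finRotate]
    simp
  · rw [Finset.card_image_of_injOn, Finset.card_range]
    intro i hi k hk h
    simp only [Finset.coe_range, Set.mem_Iio] at hi hk
    have := hbinj _ _ (by omega) (by omega) h
    omega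
  · rw [hO]
    rintro ⟨i, hi, h⟩
    have := hbinj _ _ (by omega) (by omega) h
    omega
  · rw [hO, hbs]
    exact ⟨0, by omega, rfl⟩
  · rw [hτO]
    rintro ⟨i, hi, h⟩
    have := hbinj _ _ (by omega) (by omega) h
    omega
  · rw [Finset.disjoint_left]
    intro x hx hx'
    obtain ⟨i, hi, rfl⟩ := (hO _).1 hx
    obtain ⟨k, hk, h⟩ := (hτO _).1 hx'
    have := hbinj _ _ (by omega) (by omega) h
    omega
  · rw [hτO]
    refine ⟨j - 1, by omega, ?_⟩
    rw [Equiv.Perm.eq_inv_iff_eq, hbs, ← hb0]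
    congr 1
    omega
  · intro hlt
    obtain ⟨e, he⟩ : ∃ e, e ∉ Set.range ι := by
      by_contra! h
      have := Fintype.card_le_of_surjective ι h
      simp at this
      omega
    exact ⟨e, Equiv.Perm.viaFintypeEmbedding_apply_notMem_range _ _ he⟩

theorem exists_isLift_mul_isFullCycleOn [Fintype A] (hA : 3 ≤ Fintype.card A) :
    ∃ (d₁ d₂ : Equiv.Perm (A × Fin 2)) (S : Finset (A × Fin 2)), IsLift d₁ ∧ IsLift d₂ ∧
      IsFullCycleOn S (d₁ * d₂) ∧ S.card + 1 = 2 * Fintype.card A := by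
  -- The longest odd cycle that fits: `τ` moves all of `A` if `|A|` is odd, and all but one point if
  -- `|A|` is even.
  set j := (Fintype.card A - 1) / 2 with hj
  obtain ⟨τ, O, a, hτ, hOc, haO, hτa, haτ, hO, haτ', he⟩ :=
    exists_odd_cycle_data (A := A) j (by omega) (by omega)
  have hor : Odd (Fintype.card A) ∨ ∃ e, τ e = e := by
    rcases Nat.even_or_odd (Fintype.card A) with h | h
    · exact Or.inr (he (by obtain ⟨m, hm⟩ := h; omega))
    · exact Or.inl h
  obtain ⟨s, hs⟩ := exists_commutator_isFullCycleOn haO hτa haτ hO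
  have hlift : IsLift (prodTwo τ) := ⟨τ, 1, hτ, hor, by simp⟩
  set S₀ : Finset (A × Fin 2) := insert (a, 0) ((O ∪ O.image τ) ×ˢ Finset.univ) with hS₀
  have hS₀c : S₀.card = 4 * j + 1 := by
    rw [hS₀, Finset.card_insert_of_notMem (by simp [haO, haτ] at haτ ⊢),
      Finset.card_product, Finset.card_union_of_disjoint hO,
      Finset.card_image_of_injective _ τ.injective, hOc]
    simp
    ring
  rcases Nat.even_or_odd (Fintype.card A) with h | h
  · obtain ⟨e, he⟩ := he (by obtain ⟨m, hm⟩ := h; omega)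
    set α := prodTwo τ with hα
    have heO : e ∉ O := fun h => Finset.disjoint_left.1 hO h (Finset.mem_image.2 ⟨e, h, he⟩)
    have heτ : e ∉ O.image τ := by
      intro h
      obtain ⟨x, hx, hxe⟩ := Finset.mem_image.1 h
      exact heO (by rwa [τ.injective (he.trans hxe.symm)])
    have hea : e ≠ a := by
      rintro rfl
      exact haO (by rwa [he] at hτa)
    -- For even `|A|` the commutator has length `4 * j + 1 = 2 * |A| - 3`, two points short. The
    -- points `p` and `w` will be inserted.
    set p : A × Fin 2 := (e, 0)
    set w : A × Fin 2 := (a, 1)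
    have hp : p ∉ S₀ := by
      simp only [hS₀, p, Finset.mem_insert, Finset.mem_product, Finset.mem_union, Prod.mk.injEq]
      tauto
    have hw : w ∉ S₀ := by
      simp only [hS₀, w, Finset.mem_insert, Finset.mem_product, Finset.mem_union, Prod.mk.injEq]
      simp only [Fin.one_eq_zero_iff]
      simp only [OfNat.ofNat_ne_one]
      tauto
    have hr : α⁻¹ w ∈ S₀ := by
      rw [hα, prodTwo_inv, hS₀]
      simp only [prodTwo_apply, Finset.mem_insert, Finset.mem_product, Finset.mem_union, w]
      exact Or.inr ⟨Or.inr haτ', Finset.mem_univ _⟩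
    set r := α⁻¹ w with hrdef
    set c := α * s * α⁻¹ * s⁻¹ with hc
    have hαp : α p = p := by simp [hα, p, he]
    have hcp : c p = p := hs.apply_of_notMem hp
    have hpw : p ≠ w := by simp [p, w, hea]
    have h1 := hs.swap_mul (hs.apply_mem_iff.2 hr) hp
    have h2 := h1.swap_mul (x := p) (p := w) (by simp) (by simp [hw, hpw.symm])
    -- Conjugating the second lift by `swap p r` adds both points: as `α` sends `p, r` to `p, w` and
    -- `c` fixes `p`, the product becomes `swap p w * swap p (c r) * c`, which inserts `p` and then
    -- `w`.
    refine ⟨α, Equiv.swap p r * (s * α⁻¹ * s⁻¹) * (Equiv.swap p r)⁻¹,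
      insert w (insert p S₀), hlift,
      (hlift.inv.conj s).conj _, ?_, ?_⟩
    · convert h2 using 1
      have e1 := Equiv.swap_apply_apply α p r
      have e2 := Equiv.swap_apply_apply c p r
      rw [hαp, show α r = w by simp [hrdef]] at e1
      rw [hcp] at e2
      rw [e2, Equiv.swap_comm w p, e1, Equiv.swap_inv, hc]
      group
    · rw [Finset.card_insert_of_notMem (by simp [hw, hpw.symm]), Finset.card_insert_of_notMem hp,
        hS₀c]
      obtain ⟨m, hm⟩ := h
      omega
  · refine ⟨prodTwo τ, s * (prodTwo τ)⁻¹ * s⁻¹, S₀, hlift, hlift.inv.conj s, ?_, ?_⟩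
    · simpa [mul_assoc] using hs
    · obtain ⟨m, hm⟩ := h
      omega

/-- One example is enough, since cycles of equal length are conjugate and lifts are closed under
conjugation. -/
theorem IsFullCycleOn.exists_isLift_mul [Fintype A] (hA : 3 ≤ Fintype.card A)
    {S : Finset (A × Fin 2)} {c : Equiv.Perm (A × Fin 2)} (hc : IsFullCycleOn S c)
    (hS : S.card + 1 = 2 * Fintype.card A) : ∃ d₁ d₂, IsLift d₁ ∧ IsLift d₂ ∧ c = d₁ * d₂ := by
  obtain ⟨d₁, d₂, T, h₁, h₂, hd, hT⟩ := exists_isLift_mul_isFullCycleOn hA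
  obtain ⟨k, hk⟩ := isConj_iff.1 (hd.isConj hc (by omega) (by omega))
  exact ⟨_, _, h₁.conj k, h₂.conj k, by rw [← hk]; group⟩

theorem exists_isLift_mul_mul_mul [Fintype A] (hA : 3 ≤ Fintype.card A)
    {g : Equiv.Perm (A × Fin 2)} (hg : Equiv.Perm.sign g = 1) :
    ∃ d₁ d₂ d₃ d₄, IsLift d₁ ∧ IsLift d₂ ∧ IsLift d₃ ∧ IsLift d₄ ∧ g = d₁ * d₂ * d₃ * d₄ := by
  have : Nonempty A := Fintype.card_pos_iff.1 (by omega)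
  by_cases h1 : g = 1
  · exact ⟨1, 1, 1, 1, .one, .one, .one, .one, by simp [h1]⟩
  have hcard : ∀ u : A × Fin 2, (Finset.univ.erase u).card + 1 = 2 * Fintype.card A := fun u => by
    rw [Finset.card_erase_add_one (Finset.mem_univ u)]
    simp [mul_comm]
  obtain ⟨u, w, α, c, hα, hc, rfl⟩ := exists_mul_fullCycle_of_sign_eq_one h1 hg
  obtain ⟨d₁, d₂, h₁, h₂, rfl⟩ := hα.exists_isLift_mul hA (hcard u)
  obtain ⟨d₃, d₄, h₃, h₄, rfl⟩ := hc.exists_isLift_mul hA (hcard w)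
  exact ⟨d₁, d₂, d₃, d₄, h₁, h₂, h₃, h₄, by group⟩

end Lifts

/-! ### Two-colourings and the frequencies of colour pairs. -/

section Colourings

theorem exists_perm_comp_eq_of_card_eq {T V : Type*} [Fintype T] [DecidableEq V] {φ ψ : T → V}
    (h : ∀ v, (Finset.univ.filter fun t => φ t = v).card =
      (Finset.univ.filter fun t => ψ t = v).card) :
    ∃ e : Equiv.Perm T, ∀ t, φ t = ψ (e t) := by
  have he : ∀ v, Nonempty ({t // φ t = v} ≃ {t // ψ t = v}) := fun v =>
    Fintype.card_eq.1 (by rw [Fintype.card_subtype, Fintype.card_subtype, h v])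
  refine ⟨Equiv.ofFiberEquiv fun v => (he v).some, fun t => ?_⟩
  exact (Equiv.ofFiberEquiv_map (fun v => (he v).some) t).symm

/-- By pigeonhole two points share a colour, and their transposition corrects the sign without
changing the colouring. -/
theorem exists_even_perm_comp_eq {T V : Type*} [Fintype T] [DecidableEq T] [Fintype V]
    (hTV : Fintype.card V < Fintype.card T) {φ ψ : T → V}
    (h : ∃ e : Equiv.Perm T, ∀ t, φ t = ψ (e t)) :
    ∃ e : Equiv.Perm T, Equiv.Perm.sign e = 1 ∧ ∀ t, φ t = ψ (e t) := by
  obtain ⟨e, he⟩ := h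
  rcases Int.units_eq_one_or (Equiv.Perm.sign e) with hs | hs
  · exact ⟨e, hs, he⟩
  obtain ⟨a, b, hab, hψ⟩ := Fintype.exists_ne_map_eq_of_card_lt ψ hTV
  refine ⟨Equiv.swap a b * e, by rw [map_mul, hs, Equiv.Perm.sign_swap hab]; rfl, fun t => ?_⟩
  rw [he, Equiv.Perm.mul_apply]
  by_cases h1 : e t = a
  · rw [h1, Equiv.swap_apply_left, hψ]
  by_cases h2 : e t = b
  · rw [h2, Equiv.swap_apply_right, hψ]
  · rw [Equiv.swap_apply_of_ne_of_ne h1 h2]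

/-- The number of points which `φ` sends to `v`. -/
def fiberCard {T V : Type*} [Fintype T] [DecidableEq V] (φ : T → V) (v : V) : ℕ :=
  (Finset.univ.filter fun t => φ t = v).card

theorem fiberCard_comp_perm {T V : Type*} [Fintype T] [DecidableEq V] (φ : T → V) (v : V)
    (e : Equiv.Perm T) : fiberCard (fun t => φ (e t)) v = fiberCard φ v := by
  unfold fiberCard
  exact Finset.card_equiv e (by simp)

theorem fiberCard_eq_sum {T V : Type*} [Fintype T] [DecidableEq V] (φ : T → V) (v : V) :
    fiberCard φ v = ∑ t, if φ t = v then 1 else 0 := by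
  rw [fiberCard, Finset.card_filter]

/-- Pairs of colours occur equally often in both maps as soon as the mixed pairs do and the colour
`0` does in total. -/
theorem exists_even_perm_pair {T : Type*} [Fintype T] [DecidableEq T] (hT : 4 < Fintype.card T)
    {φ ψ : T → Fin 2 × Fin 2}
    (h01 : fiberCard φ (0, 1) = fiberCard ψ (0, 1)) (h10 : fiberCard φ (1, 0) = fiberCard ψ (1, 0))
    (h00 : fiberCard φ (0, 0) = fiberCard ψ (0, 0)) :
    ∃ e : Equiv.Perm T, Equiv.Perm.sign e = 1 ∧ ∀ t, φ t = ψ (e t) := by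
  refine exists_even_perm_comp_eq (by simpa using hT) (exists_perm_comp_eq_of_card_eq ?_)
  have htot : ∀ χ : T → Fin 2 × Fin 2, fiberCard χ (0, 0) + fiberCard χ (0, 1) +
      fiberCard χ (1, 0) + fiberCard χ (1, 1) = Fintype.card T := by
    intro χ
    simp only [fiberCard_eq_sum, ← Finset.sum_add_distrib, Fintype.card_eq_sum_ones]
    refine Finset.sum_congr rfl fun t _ => ?_
    generalize χ t = v
    revert v
    decide
  have h1 := htot φ
  have h2 := htot ψ
  change ∀ v, fiberCard φ v = fiberCard ψ v
  rintro ⟨i, k⟩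
  fin_cases i <;> fin_cases k <;> simp only [Fin.zero_eta, Fin.mk_one, Fin.isValue] <;> omega

variable {A : Type*} [Fintype A]

/-- The colours of the two points over `(x, a)`. -/
def columnColours (k : Fin 2 × A × Fin 2 → Fin 2) (c : Fin 2 × A) : Fin 2 × Fin 2 :=
  (k (c.1, c.2, 0), k (c.1, c.2, 1))

/-- The colours of the two points over `(a, y)`. -/
def layerColours (k : Fin 2 × A × Fin 2 → Fin 2) (b : A × Fin 2) : Fin 2 × Fin 2 :=
  (k (0, b), k (1, b))

theorem two_mul_ite_add_ite_add_ite : ∀ u v : Fin 2,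
    ((2 * if (u, v) = (0, 0) then 1 else 0) + (if (u, v) = (0, 1) then 1 else 0) +
      if (u, v) = (1, 0) then 1 else 0) =
    (if u = 0 then 1 else 0) + if v = 0 then 1 else 0 := by
  decide

theorem two_mul_fiberCard_columnColours (k : Fin 2 × A × Fin 2 → Fin 2) :
    2 * fiberCard (columnColours k) (0, 0) + fiberCard (columnColours k) (0, 1) +
      fiberCard (columnColours k) (1, 0) = fiberCard k 0 := by
  simp only [fiberCard_eq_sum, Finset.mul_sum, ← Finset.sum_add_distrib, Fintype.sum_prod_type,
    columnColours]
  refine Finset.sum_congr rfl fun x _ => Finset.sum_congr rfl fun a _ => ?_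
  rw [Fin.sum_univ_two]
  exact two_mul_ite_add_ite_add_ite _ _

theorem two_mul_fiberCard_layerColours (k : Fin 2 × A × Fin 2 → Fin 2) :
    2 * fiberCard (layerColours k) (0, 0) + fiberCard (layerColours k) (0, 1) +
      fiberCard (layerColours k) (1, 0) = fiberCard k 0 := by
  rw [fiberCard_eq_sum k, Fintype.sum_prod_type, Fin.sum_univ_two, ← Finset.sum_add_distrib]
  simp only [fiberCard_eq_sum, Finset.mul_sum, ← Finset.sum_add_distrib, layerColours]
  refine Finset.sum_congr rfl fun b _ => ?_
  exact two_mul_ite_add_ite_add_ite _ _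

theorem card_filter_index {n : ℕ} (ε : A ≃ Fin n) (p : ℕ → Prop) [DecidablePred p] :
    ((Finset.univ : Finset (A × Fin 2)).filter fun b => p (2 * (ε b.1 : ℕ) + b.2)).card =
      ((Finset.range (2 * n)).filter p).card := by
  refine Finset.card_bij (fun b _ => 2 * (ε b.1 : ℕ) + b.2) ?_ ?_ ?_
  · rintro ⟨a, y⟩ h
    have := (ε a).isLt
    simp only [Finset.mem_filter, Finset.mem_univ, true_and, Finset.mem_range] at h ⊢
    exact ⟨by omega, h⟩
  · rintro ⟨a, y⟩ - ⟨a', y'⟩ - h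
    simp only at h
    have h1 : ε a = ε a' := Fin.ext (by omega)
    have h2 : y = y' := Fin.ext (by omega)
    rw [ε.injective h1, h2]
  · intro i hi
    simp only [Finset.mem_filter, Finset.mem_range] at hi
    refine ⟨(ε.symm ⟨i / 2, by omega⟩, ⟨i % 2, by omega⟩), ?_, ?_⟩
    · simpa [Nat.div_add_mod] using hi.2
    · simp [Nat.div_add_mod]

/-- An interval boundary at `m` cuts through a pair `{2i, 2i + 1}` exactly when `m` is odd, and then
through only one. -/
theorem sum_ite_index {n : ℕ} (ε : A ≃ Fin n) {m : ℕ} (hm : m ≤ 2 * n) :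
    (∑ a, if 2 * (ε a : ℕ) + 1 = m then 1 else 0) = m % 2 := by
  rw [Equiv.sum_comp ε (fun i : Fin n => if 2 * (i : ℕ) + 1 = m then 1 else 0)]
  rcases Nat.mod_two_eq_zero_or_one m with h | h
  · rw [h]
    exact Finset.sum_eq_zero fun i _ => if_neg (by omega)
  · rw [h, Finset.sum_eq_single ⟨m / 2, by omega⟩]
    · simp
      omega
    · intro i _ hi
      refine if_neg fun h' => hi (Fin.ext ?_)
      simp
      omega
    · simp

/-- The colouring by intervals with respect to the enumeration `2 ε(a) + y` of `A × 2`: on the layer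
`x = 0`, colour `0` is used on `[0, P)`, and on the layer `x = 1`, outside `[c, P + c)`. -/
def intervalColouring {n : ℕ} (ε : A ≃ Fin n) (P c : ℕ) (z : Fin 2 × A × Fin 2) : Fin 2 :=
  let i := 2 * (ε z.2.1 : ℕ) + z.2.2
  if z.1 = 0 then (if i < P then 0 else 1) else (if i < c ∨ P + c ≤ i then 0 else 1)

/-- The boundaries `c ≤ P ≤ P + c` cut `[0, 2n)` into intervals carrying the pairs `00`, `01`, `11`,
`10` in this order. -/
theorem fiberCard_layerColours_intervalColouring {n : ℕ} (ε : A ≃ Fin n) {P c : ℕ} (hcP : c ≤ P)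
    (hP : P + c ≤ 2 * n) :
    fiberCard (layerColours (intervalColouring ε P c)) (0, 0) = c ∧
      fiberCard (layerColours (intervalColouring ε P c)) (0, 1) = P - c ∧
      fiberCard (layerColours (intervalColouring ε P c)) (1, 0) = 2 * n - P - c := by
  refine ⟨?_, ?_, ?_⟩
  · trans ((Finset.range (2 * n)).filter fun i => i < c).card
    · rw [← card_filter_index ε, fiberCard]
      congr 1
      ext b
      simp [layerColours, intervalColouring]
      omega
    · rw [show ((Finset.range (2 * n)).filter fun i => i < c) = Finset.range c by ext; simp; omega]
      simp
  · trans ((Finset.range (2 * n)).filter fun i => c ≤ i ∧ i < P).card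
    · rw [← card_filter_index ε, fiberCard]
      congr 1
      ext b
      simp [layerColours, intervalColouring]
      omega
    · rw [show ((Finset.range (2 * n)).filter fun i => c ≤ i ∧ i < P) = Finset.Ico c P by
        ext; simp; omega]
      simp
  · trans ((Finset.range (2 * n)).filter fun i => P + c ≤ i).card
    · rw [← card_filter_index ε, fiberCard]
      congr 1
      ext b
      simp [layerColours, intervalColouring]
      omega
    · rw [show ((Finset.range (2 * n)).filter fun i => P + c ≤ i) = Finset.Ico (P + c) (2 * n) by
        ext; simp; omega]
      simp
      omega

/-- Mixed columns arise only at odd boundaries: `P` on layer `0` and `c` on layer `1` pass from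
colour `0` to `1`, and `P + c` on layer `1` passes back. Hence at most two columns are mixed. -/
theorem fiberCard_columnColours_intervalColouring {n : ℕ} (ε : A ≃ Fin n) {P c : ℕ} (hcP : c ≤ P)
    (hP : P + c ≤ 2 * n) :
    fiberCard (columnColours (intervalColouring ε P c)) (0, 1) = P % 2 + c % 2 ∧
      fiberCard (columnColours (intervalColouring ε P c)) (1, 0) = (P + c) % 2 := by
  constructor
  · rw [fiberCard_eq_sum, Fintype.sum_prod_type, Fin.sum_univ_two,
      ← sum_ite_index ε (by omega : P ≤ 2 * n), ← sum_ite_index ε (by omega : c ≤ 2 * n)]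
    congr 1 <;> refine Finset.sum_congr rfl fun a _ => if_congr ?_ rfl rfl
    · simp [columnColours, intervalColouring]
      omega
    · simp [columnColours, intervalColouring]
      omega
  · rw [fiberCard_eq_sum, Fintype.sum_prod_type, Fin.sum_univ_two, ← sum_ite_index ε hP,
      Finset.sum_eq_zero, zero_add]
    · refine Finset.sum_congr rfl fun a _ => if_congr ?_ rfl rfl
      simp [columnColours, intervalColouring]
      omega
    · intro a _
      refine if_neg ?_
      simp [columnColours, intervalColouring]
      omega

theorem fiberCard_fst : fiberCard (fun z : Fin 2 × A × Fin 2 => z.1) 0 = 2 * Fintype.card A := by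
  rw [fiberCard_eq_sum, Fintype.sum_prod_type, Fin.sum_univ_two]
  simp [mul_comm]

variable [DecidableEq A]

theorem exists_permTimesTwo_comp (hA : 3 ≤ Fintype.card A) {k k' : Fin 2 × A × Fin 2 → Fin 2}
    (h0 : fiberCard k 0 = fiberCard k' 0)
    (h01 : fiberCard (columnColours k) (0, 1) = fiberCard (columnColours k') (0, 1))
    (h10 : fiberCard (columnColours k) (1, 0) = fiberCard (columnColours k') (1, 0)) :
    ∃ f : Equiv.Perm (Fin 2 × A), Equiv.Perm.sign f = 1 ∧ ∀ z, k z = k' (permTimesTwo f z) := by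
  have h1 := two_mul_fiberCard_columnColours k
  have h2 := two_mul_fiberCard_columnColours k'
  obtain ⟨f, hf, h⟩ := exists_even_perm_pair (by simp; omega) h01 h10 (by omega)
  refine ⟨f, hf, ?_⟩
  rintro ⟨x, a, y⟩
  have := h (x, a)
  simp only [columnColours, Prod.mk.injEq] at this
  rw [permTimesTwo_apply]
  fin_cases y
  exacts [this.1, this.2]

theorem exists_twoTimesPerm_comp (hA : 3 ≤ Fintype.card A) {k k' : Fin 2 × A × Fin 2 → Fin 2}
    (h00 : fiberCard (layerColours k) (0, 0) = fiberCard (layerColours k') (0, 0))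
    (h01 : fiberCard (layerColours k) (0, 1) = fiberCard (layerColours k') (0, 1))
    (h10 : fiberCard (layerColours k) (1, 0) = fiberCard (layerColours k') (1, 0)) :
    ∃ g : Equiv.Perm (A × Fin 2), Equiv.Perm.sign g = 1 ∧ ∀ z, k z = k' (twoTimesPerm g z) := by
  obtain ⟨g, hg, h⟩ := exists_even_perm_pair (by simp; omega) h01 h10 h00
  refine ⟨g, hg, ?_⟩
  rintro ⟨x, b⟩
  have := h b
  simp only [layerColours, Prod.mk.injEq] at this
  rw [twoTimesPerm_apply]
  fin_cases x
  exacts [this.1, this.2]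

theorem exists_twoTimesPerm_comp_of_exists (hA : 3 ≤ Fintype.card A)
    {k k' : Fin 2 × A × Fin 2 → Fin 2} (g : Equiv.Perm (A × Fin 2))
    (h : ∀ x b, k (x, b) = k' (x, g b)) :
    ∃ g : Equiv.Perm (A × Fin 2), Equiv.Perm.sign g = 1 ∧ ∀ z, k z = k' (twoTimesPerm g z) := by
  have hk : layerColours k = fun b => layerColours k' (g b) := by
    funext b
    simp [layerColours, h]
  refine exists_twoTimesPerm_comp hA ?_ ?_ ?_ <;> rw [hk, fiberCard_comp_perm]

/-- The colouring by the first coordinate, changed to `0` over `a₁` and to `1` over `a₂`. -/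
def pivotColouring (a₁ a₂ : A) (z : Fin 2 × A × Fin 2) : Fin 2 :=
  if z.2.1 = a₁ then 0 else if z.2.1 = a₂ then 1 else z.1

end Colourings

/-! ### Straightening to a layerwise even permutation, and the count of factors. -/

section Reduction

variable {A : Type*}

theorem prodCongrRight_mul {X Y : Type*} (γ δ : X → Equiv.Perm Y) :
    (Equiv.prodCongrRight fun x => γ x * δ x : Equiv.Perm (X × Y)) =
      (Equiv.prodCongrRight γ : Equiv.Perm (X × Y)) * Equiv.prodCongrRight δ := rfl

theorem twoTimesPerm_eq (g : Equiv.Perm (A × Fin 2)) :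
    twoTimesPerm g = Equiv.prodCongrRight fun _ => g := rfl

theorem permTimesTwo_prodCongrRight (τ : Fin 2 → Equiv.Perm A) :
    permTimesTwo (Equiv.prodCongrRight τ) = Equiv.prodCongrRight fun x => prodTwo (τ x) := rfl

theorem permTimesTwo_inv (f : Equiv.Perm (Fin 2 × A)) :
    (permTimesTwo f)⁻¹ = permTimesTwo f⁻¹ := rfl

theorem twoTimesPerm_inv (g : Equiv.Perm (A × Fin 2)) :
    (twoTimesPerm g)⁻¹ = twoTimesPerm g⁻¹ := rfl

theorem twoTimesPerm_mul (g h : Equiv.Perm (A × Fin 2)) :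
    twoTimesPerm (g * h) = twoTimesPerm g * twoTimesPerm h := rfl

theorem exists_eq_prodCongrRight {X Y : Type*} [Finite Y] (π : Equiv.Perm (X × Y))
    (h : ∀ z, (π z).1 = z.1) : ∃ γ : X → Equiv.Perm Y, π = Equiv.prodCongrRight γ := by
  have hinj : ∀ x, Function.Injective fun b => (π (x, b)).2 := by
    intro x b b' hb
    have : π (x, b) = π (x, b') := Prod.ext ((h (x, b)).trans (h (x, b')).symm) hb
    exact (Prod.mk.inj (π.injective this)).2
  refine ⟨fun x => Equiv.ofBijective _ (Finite.injective_iff_bijective.1 (hinj x)), ?_⟩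
  ext ⟨x, b⟩ : 1
  exact Prod.ext (h _) rfl

variable [DecidableEq A]

/-- The exchange of the two points over `a`. -/
def flipAt (a : A) : Equiv.Perm (A × Fin 2) := Equiv.swap (a, 0) (a, 1)

theorem flipAt_self (a : A) (y : Fin 2) : flipAt a (a, y) = (a, 1 - y) := by
  fin_cases y <;> simp [flipAt]

theorem flipAt_of_ne {a b : A} (h : b ≠ a) (y : Fin 2) : flipAt a (b, y) = (b, y) :=
  Equiv.swap_apply_of_ne_of_ne (by simp [h]) (by simp [h])

/-- The even permutation taking the pivot colouring to the first coordinate. -/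
def pivotPerm (a₁ a₂ a₃ : A) : Equiv.Perm (Fin 2 × A) :=
  Equiv.swap (1, a₁) (0, a₂) * Equiv.swap (0, a₁) (0, a₃)

theorem pivotPerm_apply {a₁ a₂ a₃ : A} (h₁₂ : a₁ ≠ a₂) (h₁₃ : a₁ ≠ a₃) (h₂₃ : a₂ ≠ a₃)
    (x : Fin 2) (a : A) :
    pivotPerm a₁ a₂ a₃ (x, a) =
      if a = a₁ then (0, if x = 0 then a₃ else a₂)
      else if a = a₂ then (1, if x = 0 then a₁ else a₂)
      else if a = a₃ then (x, if x = 0 then a₁ else a₃) else (x, a) := by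
  rw [pivotPerm, Equiv.Perm.mul_apply]
  by_cases e1 : a = a₁
  · subst e1
    fin_cases x <;> simp [Equiv.swap_apply_def, h₁₃, h₁₃.symm, h₂₃.symm]
  by_cases e2 : a = a₂
  · subst e2
    fin_cases x <;> simp [Equiv.swap_apply_def, h₂₃, h₁₂.symm]
  by_cases e3 : a = a₃
  · subst e3
    fin_cases x <;> simp [Equiv.swap_apply_def, h₁₂, h₁₃.symm, h₂₃.symm]
  · simp [Equiv.swap_apply_def, e1, e2, e3]

theorem pivotColouring_eq {a₁ a₂ a₃ : A} (h₁₂ : a₁ ≠ a₂) (h₁₃ : a₁ ≠ a₃) (h₂₃ : a₂ ≠ a₃)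
    (z : Fin 2 × A × Fin 2) :
    pivotColouring a₁ a₂ z = (permTimesTwo (pivotPerm a₁ a₂ a₃) z).1 := by
  obtain ⟨x, a, y⟩ := z
  rw [permTimesTwo_apply, pivotPerm_apply h₁₂ h₁₃ h₂₃, pivotColouring]
  split_ifs <;> rfl

/-- Parity correction: of the four columns flipped by the even `flipAt a₁ * flipAt a₃`, the pivot
permutation puts three on layer `0` and one on layer `1`, an odd number on each. -/
theorem pivotPerm_mul_flips {a₁ a₂ a₃ : A} (h₁₂ : a₁ ≠ a₂) (h₁₃ : a₁ ≠ a₃) (h₂₃ : a₂ ≠ a₃) :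
    permTimesTwo (pivotPerm a₁ a₂ a₃) * twoTimesPerm (flipAt a₁ * flipAt a₃) =
      Equiv.prodCongrRight ![flipAt a₁ * flipAt a₂ * flipAt a₃, flipAt a₃] *
        permTimesTwo (pivotPerm a₁ a₂ a₃) := by
  ext ⟨x, a, y⟩ : 1
  simp only [Equiv.Perm.mul_apply, twoTimesPerm_apply, permTimesTwo_apply,
    pivotPerm_apply h₁₂ h₁₃ h₂₃]
  by_cases e1 : a = a₁
  · subst e1
    fin_cases x <;>
      simp [flipAt_self, flipAt_of_ne, pivotPerm_apply, permTimesTwo_apply, h₁₂, h₁₃, h₂₃,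
        h₁₂.symm, h₁₃.symm, h₂₃.symm]
  by_cases e2 : a = a₂
  · subst e2
    fin_cases x <;>
      simp [flipAt_of_ne, pivotPerm_apply, permTimesTwo_apply, h₁₂, h₁₃, h₂₃,
        h₁₂.symm]
  by_cases e3 : a = a₃
  · subst e3
    fin_cases x <;>
      simp [flipAt_self, flipAt_of_ne, pivotPerm_apply, permTimesTwo_apply, h₁₂, h₁₃, h₂₃,
        h₁₃.symm, h₂₃.symm]
  · fin_cases x <;>
      simp [flipAt_of_ne, pivotPerm_apply, permTimesTwo_apply, h₁₂, h₁₃, h₂₃, e1, e2, e3]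

/-- The pivot colouring after exchanging `(a₁, 1)` with `(a₃, i)`. -/
def swappedPivotColouring (a₁ a₂ a₃ : A) (i : Fin 2) (z : Fin 2 × A × Fin 2) : Fin 2 :=
  pivotColouring a₁ a₂ (twoTimesPerm (Equiv.swap (a₁, 1) (a₃, i)) z)

theorem columnColours_swappedPivotColouring {a₁ a₂ a₃ : A} (h₁₂ : a₁ ≠ a₂) (h₁₃ : a₁ ≠ a₃)
    (h₂₃ : a₂ ≠ a₃) (i x : Fin 2) (a : A) :
    columnColours (swappedPivotColouring a₁ a₂ a₃ i) (x, a) =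
      if a = a₁ then (0, x) else if a = a₂ then (1, 1)
      else if a = a₃ then (if i = 0 then (0, x) else (x, 0)) else (x, x) := by
  simp only [columnColours, swappedPivotColouring, twoTimesPerm_apply, pivotColouring]
  by_cases e1 : a = a₁
  · subst e1
    simp [Equiv.swap_apply_def, h₁₃, h₁₃.symm, h₂₃.symm]
  by_cases e2 : a = a₂
  · subst e2
    simp [Equiv.swap_apply_def, h₂₃, h₁₂.symm]
  by_cases e3 : a = a₃
  · subst e3
    fin_cases i <;>
      simp [Equiv.swap_apply_def, h₁₃.symm, h₂₃.symm]
  · simp [Equiv.swap_apply_def, e1, e2, e3]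

variable [Fintype A]

theorem sign_twoTimesPerm (g : Equiv.Perm (A × Fin 2)) : Equiv.Perm.sign (twoTimesPerm g) = 1 := by
  rw [twoTimesPerm_eq, Equiv.Perm.sign_prodCongrRight, Fin.prod_univ_two, Int.units_mul_self]

theorem sign_permTimesTwo (f : Equiv.Perm (Fin 2 × A)) :
    Equiv.Perm.sign (permTimesTwo f) = 1 := by
  rw [permTimesTwo, Equiv.Perm.sign_permCongr,
    show Equiv.prodCongr f (Equiv.refl (Fin 2)) = Equiv.prodCongrLeft fun _ => f from rfl,
    Equiv.Perm.sign_prodCongrLeft, Fin.prod_univ_two, Int.units_mul_self]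

theorem sign_flipAt (a : A) : Equiv.Perm.sign (flipAt a) = -1 :=
  Equiv.Perm.sign_swap (by simp)

theorem sign_pivotPerm {a₁ a₃ : A} (h₁₃ : a₁ ≠ a₃) (a₂ : A) :
    Equiv.Perm.sign (pivotPerm a₁ a₂ a₃) = 1 := by
  rw [pivotPerm, map_mul, Equiv.Perm.sign_swap (by simp), Equiv.Perm.sign_swap (by simp [h₁₃])]
  rfl

theorem fiberCard_columnColours_pivotColouring (a₁ a₂ : A) :
    fiberCard (columnColours (pivotColouring a₁ a₂)) (0, 1) = 0 ∧
      fiberCard (columnColours (pivotColouring a₁ a₂)) (1, 0) = 0 := by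
  constructor <;>
  · rw [fiberCard_eq_sum]
    refine Finset.sum_eq_zero fun c _ => if_neg ?_
    rw [columnColours, Prod.mk.injEq]
    rintro ⟨h, h'⟩
    rw [show pivotColouring a₁ a₂ (c.1, c.2, 0) = pivotColouring a₁ a₂ (c.1, c.2, 1) from rfl,
      h'] at h
    exact absurd h (by decide)

theorem fiberCard_columnColours_swappedPivotColouring_zero {a₁ a₂ a₃ : A} (h₁₂ : a₁ ≠ a₂)
    (h₁₃ : a₁ ≠ a₃) (h₂₃ : a₂ ≠ a₃) :
    fiberCard (columnColours (swappedPivotColouring a₁ a₂ a₃ 0)) (0, 1) = 2 ∧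
      fiberCard (columnColours (swappedPivotColouring a₁ a₂ a₃ 0)) (1, 0) = 0 := by
  constructor
  · rw [fiberCard, Finset.card_eq_two]
    refine ⟨(1, a₁), (1, a₃), by simp [h₁₃], ?_⟩
    ext ⟨x, a⟩
    rw [Finset.mem_filter, columnColours_swappedPivotColouring h₁₂ h₁₃ h₂₃]
    fin_cases x <;> simp <;> grind
  · rw [fiberCard, Finset.card_eq_zero]
    ext ⟨x, a⟩
    rw [Finset.mem_filter, columnColours_swappedPivotColouring h₁₂ h₁₃ h₂₃]
    fin_cases x <;> simp <;> grind

theorem fiberCard_columnColours_swappedPivotColouring_one {a₁ a₂ a₃ : A} (h₁₂ : a₁ ≠ a₂)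
    (h₁₃ : a₁ ≠ a₃) (h₂₃ : a₂ ≠ a₃) :
    fiberCard (columnColours (swappedPivotColouring a₁ a₂ a₃ 1)) (0, 1) = 1 ∧
      fiberCard (columnColours (swappedPivotColouring a₁ a₂ a₃ 1)) (1, 0) = 1 := by
  constructor
  · rw [fiberCard, Finset.card_eq_one]
    refine ⟨(1, a₁), ?_⟩
    ext ⟨x, a⟩
    rw [Finset.mem_filter, columnColours_swappedPivotColouring h₁₂ h₁₃ h₂₃]
    fin_cases x <;> simp <;> grind
  · rw [fiberCard, Finset.card_eq_one]
    refine ⟨(1, a₃), ?_⟩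
    ext ⟨x, a⟩
    rw [Finset.mem_filter, columnColours_swappedPivotColouring h₁₂ h₁₃ h₂₃]
    fin_cases x <;> simp <;> grind

/-- The parities of `P` and `c` allow only the mixed counts `(0, 0)`, `(1, 1)` and `(2, 0)`, and one
transposition at most produces each from the pivot colouring. The first coordinate itself would not
do: each of its vertical pairs is `01`, so no `2 × g` changes it. -/
theorem exists_swap_colouring {a₁ a₂ a₃ : A} (h₁₂ : a₁ ≠ a₂) (h₁₃ : a₁ ≠ a₃) (h₂₃ : a₂ ≠ a₃)
    {k : Fin 2 × A × Fin 2 → Fin 2} {P c : ℕ}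
    (h01 : fiberCard (columnColours k) (0, 1) = P % 2 + c % 2)
    (h10 : fiberCard (columnColours k) (1, 0) = (P + c) % 2) :
    ∃ g : Equiv.Perm (A × Fin 2),
      fiberCard (columnColours k) (0, 1) =
        fiberCard (columnColours fun z => pivotColouring a₁ a₂ (twoTimesPerm g z)) (0, 1) ∧
      fiberCard (columnColours k) (1, 0) =
        fiberCard (columnColours fun z => pivotColouring a₁ a₂ (twoTimesPerm g z)) (1, 0) := by
  rcases Nat.mod_two_eq_zero_or_one P with hP | hP <;>
    rcases Nat.mod_two_eq_zero_or_one c with hc | hc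
  · obtain ⟨h, h'⟩ := fiberCard_columnColours_pivotColouring a₁ a₂
    exact ⟨1, h01.trans (by rw [hP, hc]; exact h.symm), h10.trans ((by omega : _ = 0).trans h'.symm)⟩
  · obtain ⟨h, h'⟩ := fiberCard_columnColours_swappedPivotColouring_one h₁₂ h₁₃ h₂₃
    exact ⟨_, h01.trans (by rw [hP, hc]; exact h.symm), h10.trans ((by omega : _ = 1).trans h'.symm)⟩
  · obtain ⟨h, h'⟩ := fiberCard_columnColours_swappedPivotColouring_one h₁₂ h₁₃ h₂₃
    exact ⟨_, h01.trans (by rw [hP, hc]; exact h.symm), h10.trans ((by omega : _ = 1).trans h'.symm)⟩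
  · obtain ⟨h, h'⟩ := fiberCard_columnColours_swappedPivotColouring_zero h₁₂ h₁₃ h₂₃
    exact ⟨_, h01.trans (by rw [hP, hc]; exact h.symm), h10.trans ((by omega : _ = 0).trans h'.symm)⟩

/-- Three factors take a balanced colouring to the pivot colouring. -/
theorem exists_comp_eq_pivotColouring (hA : 3 ≤ Fintype.card A) {a₁ a₂ a₃ : A} (h₁₂ : a₁ ≠ a₂)
    (h₁₃ : a₁ ≠ a₃) (h₂₃ : a₂ ≠ a₃) (k : Fin 2 × A × Fin 2 → Fin 2)
    (hk : fiberCard k 0 = 2 * Fintype.card A) :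
    ∃ (g₁ : Equiv.Perm (A × Fin 2)) (f : Equiv.Perm (Fin 2 × A)) (g₂ : Equiv.Perm (A × Fin 2)),
      Equiv.Perm.sign g₁ = 1 ∧ Equiv.Perm.sign f = 1 ∧ Equiv.Perm.sign g₂ = 1 ∧
      ∀ z, k z = pivotColouring a₁ a₂ ((twoTimesPerm g₂ * permTimesTwo f * twoTimesPerm g₁) z) := by
  -- `c` and `P` are chosen to match the `00` and `01` counts of `k`; since `k` is balanced, the
  -- `10` count then agrees too.
  set c := fiberCard (layerColours k) (0, 0) with hc
  set P := c + fiberCard (layerColours k) (0, 1) with hP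
  have htot := two_mul_fiberCard_layerColours k
  have hPc : P + c ≤ 2 * Fintype.card A := by omega
  set ε := Fintype.equivFin A
  obtain ⟨hL00, hL01, hL10⟩ := fiberCard_layerColours_intervalColouring ε (by omega : c ≤ P) hPc
  obtain ⟨hC01, hC10⟩ := fiberCard_columnColours_intervalColouring ε (by omega : c ≤ P) hPc
  obtain ⟨g₁, hg₁, hk₁⟩ := exists_twoTimesPerm_comp (k := k) (k' := intervalColouring ε P c) hA
    (by omega) (by omega) (by omega)
  have hcard : fiberCard (intervalColouring ε P c) 0 = 2 * Fintype.card A := by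
    rw [← hk, funext hk₁]
    exact (fiberCard_comp_perm (intervalColouring ε P c) 0 (twoTimesPerm g₁)).symm
  have hpivot : fiberCard (pivotColouring a₁ a₂) 0 = 2 * Fintype.card A := by
    rw [funext (pivotColouring_eq h₁₂ h₁₃ h₂₃), ← fiberCard_fst]
    exact fiberCard_comp_perm (fun z => z.1) 0 (permTimesTwo (pivotPerm a₁ a₂ a₃))
  obtain ⟨g, h01, h10⟩ := exists_swap_colouring h₁₂ h₁₃ h₂₃ hC01 hC10
  obtain ⟨f, hf, hk₂⟩ := exists_permTimesTwo_comp hA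
    (k' := fun z => pivotColouring a₁ a₂ (twoTimesPerm g z))
    (by rw [hcard, fiberCard_comp_perm, hpivot]) h01 h10
  -- The transposition `g` may be odd; an even permutation with the same effect on the colouring
  -- replaces it.
  obtain ⟨g₂, hg₂, hk₃⟩ := exists_twoTimesPerm_comp_of_exists hA
    (k := fun z => pivotColouring a₁ a₂ (twoTimesPerm g z)) (k' := pivotColouring a₁ a₂) g
    fun _ _ => rfl
  refine ⟨g₁, f, g₂, hg₁, hf, hg₂, fun z => ?_⟩
  rw [hk₁, hk₂, Equiv.Perm.mul_apply, Equiv.Perm.mul_apply, ← hk₃]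

theorem exists_mul_eq_prodCongrRight (hA : 3 ≤ Fintype.card A)
    {σ : Equiv.Perm (Fin 2 × A × Fin 2)} (hσ : Equiv.Perm.sign σ = 1) :
    ∃ (g₁ : Equiv.Perm (A × Fin 2)) (f₁ : Equiv.Perm (Fin 2 × A)) (g₂ : Equiv.Perm (A × Fin 2))
      (f₂ : Equiv.Perm (Fin 2 × A)) (γ : Fin 2 → Equiv.Perm (A × Fin 2)),
      Equiv.Perm.sign g₁ = 1 ∧ Equiv.Perm.sign f₁ = 1 ∧ Equiv.Perm.sign g₂ = 1 ∧
      Equiv.Perm.sign f₂ = 1 ∧ (∀ x, Equiv.Perm.sign (γ x) = 1) ∧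
      σ = twoTimesPerm g₁ * permTimesTwo f₁ * twoTimesPerm g₂ * permTimesTwo f₂ *
        Equiv.prodCongrRight γ := by
  obtain ⟨a₁, a₂, a₃, h₁₂, h₁₃, h₂₃⟩ := Fintype.two_lt_card_iff.1 hA
  have hk : fiberCard (fun z => (σ⁻¹ z).1) 0 = 2 * Fintype.card A := by
    rw [← fiberCard_fst]
    exact fiberCard_comp_perm (fun z => z.1) 0 σ⁻¹
  obtain ⟨g₁, f, g₂, hg₁, hf, hg₂, h⟩ := exists_comp_eq_pivotColouring hA h₁₂ h₁₃ h₂₃ _ hk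
  set p := pivotPerm a₁ a₂ a₃
  have hp : Equiv.Perm.sign p = 1 := sign_pivotPerm h₁₃ a₂
  have key : ∀ (g : Equiv.Perm (A × Fin 2)) (γ : Fin 2 → Equiv.Perm (A × Fin 2)),
      Equiv.Perm.sign g = 1 → (∀ x, Equiv.Perm.sign (γ x) = 1) →
      permTimesTwo p * twoTimesPerm g * permTimesTwo f * twoTimesPerm g₁ * σ =
        Equiv.prodCongrRight γ →
      ∃ (g₁ : Equiv.Perm (A × Fin 2)) (f₁ : Equiv.Perm (Fin 2 × A)) (g₂ : Equiv.Perm (A × Fin 2))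
        (f₂ : Equiv.Perm (Fin 2 × A)) (γ : Fin 2 → Equiv.Perm (A × Fin 2)),
        Equiv.Perm.sign g₁ = 1 ∧ Equiv.Perm.sign f₁ = 1 ∧ Equiv.Perm.sign g₂ = 1 ∧
        Equiv.Perm.sign f₂ = 1 ∧ (∀ x, Equiv.Perm.sign (γ x) = 1) ∧
        σ = twoTimesPerm g₁ * permTimesTwo f₁ * twoTimesPerm g₂ * permTimesTwo f₂ *
          Equiv.prodCongrRight γ := by
    intro g γ hg hγ heq
    refine ⟨g₁⁻¹, f⁻¹, g⁻¹, p⁻¹, γ, by simpa, by simpa, by simpa, by simpa, hγ, ?_⟩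
    rw [← heq, ← twoTimesPerm_inv, ← twoTimesPerm_inv, ← permTimesTwo_inv, ← permTimesTwo_inv]
    group
  obtain ⟨γ, hγ⟩ := exists_eq_prodCongrRight
    (permTimesTwo p * twoTimesPerm g₂ * permTimesTwo f * twoTimesPerm g₁ * σ) (by
      intro z
      have := h (σ z)
      rw [pivotColouring_eq h₁₂ h₁₃ h₂₃] at this
      simpa using this.symm)
  have hsign : Equiv.Perm.sign (γ 0) * Equiv.Perm.sign (γ 1) = 1 := by
    rw [← Fin.prod_univ_two fun x => Equiv.Perm.sign (γ x), ← Equiv.Perm.sign_prodCongrRight, ← hγ]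
    simp only [map_mul, sign_permTimesTwo, sign_twoTimesPerm, hσ, mul_one]
  rcases Int.units_eq_one_or (Equiv.Perm.sign (γ 0)) with h0 | h0
  · rw [h0, one_mul] at hsign
    exact key g₂ γ hg₂ (by rw [Fin.forall_fin_two]; exact ⟨h0, hsign⟩) hγ
  · have h1 : Equiv.Perm.sign (γ 1) = -1 := by
      rcases Int.units_eq_one_or (Equiv.Perm.sign (γ 1)) with h1 | h1
      · rw [h0, h1] at hsign
        exact absurd hsign (by decide)
      · exact h1
    -- Both layers are odd here; the even correction merges with `g₂` and costs no extra factor.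
    refine key (flipAt a₁ * flipAt a₃ * g₂)
      (fun x => (![flipAt a₁ * flipAt a₂ * flipAt a₃, flipAt a₃] : Fin 2 → _) x * γ x)
      (by simp [sign_flipAt, hg₂]) ?_ ?_
    · rw [Fin.forall_fin_two]
      simp [sign_flipAt, h0, h1]
    · rw [prodCongrRight_mul, ← hγ, twoTimesPerm_mul _ g₂, ← mul_assoc (permTimesTwo p),
        pivotPerm_mul_flips h₁₂ h₁₃ h₂₃]
      simp only [mul_assoc, p]

theorem hasEvenAlternationDepth_prodCongrRight (hA : 3 ≤ Fintype.card A)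
    {γ : Fin 2 → Equiv.Perm (A × Fin 2)} (hγ : ∀ x, Equiv.Perm.sign (γ x) = 1) :
    HasEvenAlternationDepth (Equiv.prodCongrRight γ) 9 := by
  obtain ⟨d₁, d₂, d₃, d₄, h₁, h₂, h₃, h₄, hd⟩ :=
    exists_isLift_mul_mul_mul hA (g := (γ 0)⁻¹ * γ 1) (by simp [hγ])
  obtain ⟨τ₁, k₁, hτ₁, hk₁, rfl⟩ := h₁.exists_even
  obtain ⟨τ₂, k₂, hτ₂, hk₂, rfl⟩ := h₂.exists_even
  obtain ⟨τ₃, k₃, hτ₃, hk₃, rfl⟩ := h₃.exists_even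
  obtain ⟨τ₄, k₄, hτ₄, hk₄, rfl⟩ := h₄.exists_even
  -- Adjacent conjugators are merged. On layer `0` the list telescopes to `γ 0`; on layer `1` it
  -- gives `γ 0` times the four lifts, that is, `γ 1`.
  refine ⟨[twoTimesPerm (γ 0 * k₁), permTimesTwo (Equiv.prodCongrRight ![1, τ₁]),
    twoTimesPerm (k₁⁻¹ * k₂), permTimesTwo (Equiv.prodCongrRight ![1, τ₂]),
    twoTimesPerm (k₂⁻¹ * k₃), permTimesTwo (Equiv.prodCongrRight ![1, τ₃]),
    twoTimesPerm (k₃⁻¹ * k₄), permTimesTwo (Equiv.prodCongrRight ![1, τ₄]),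
    twoTimesPerm k₄⁻¹], rfl, ?_, ?_⟩
  · simp only [List.prod_cons, List.prod_nil, mul_one, twoTimesPerm_eq, permTimesTwo_prodCongrRight,
      ← prodCongrRight_mul]
    congr 1
    funext x
    fin_cases x
    · simp only [Fin.zero_eta, Matrix.cons_val_zero, prodTwo_one]
      group
    · simp only [Fin.mk_one, Matrix.cons_val_one, Matrix.cons_val_fin_one]
      rw [inv_mul_eq_iff_eq_mul] at hd
      rw [hd]
      group
  · simp only [List.mem_cons, List.not_mem_nil, or_false]
    have hT : ∀ g : Equiv.Perm (A × Fin 2), Equiv.Perm.sign g = 1 →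
        ∃ g', Equiv.Perm.sign g' = 1 ∧ twoTimesPerm g = twoTimesPerm g' := fun g hg => ⟨g, hg, rfl⟩
    have hF : ∀ τ : Equiv.Perm A, Equiv.Perm.sign τ = 1 →
        ∃ f, Equiv.Perm.sign f = 1 ∧
          permTimesTwo (Equiv.prodCongrRight ![1, τ]) = permTimesTwo f := fun τ hτ =>
      ⟨_, by rw [Equiv.Perm.sign_prodCongrRight]; simp [hτ], rfl⟩
    rintro τ (rfl | rfl | rfl | rfl | rfl | rfl | rfl | rfl | rfl)
    · exact Or.inr (hT _ (by simp [hγ, hk₁]))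
    · exact Or.inl (hF _ hτ₁)
    · exact Or.inr (hT _ (by simp [hk₁, hk₂]))
    · exact Or.inl (hF _ hτ₂)
    · exact Or.inr (hT _ (by simp [hk₂, hk₃]))
    · exact Or.inl (hF _ hτ₃)
    · exact Or.inr (hT _ (by simp [hk₃, hk₄]))
    · exact Or.inl (hF _ hτ₄)
    · exact Or.inr (hT _ (by simp [hk₄]))

end Reduction

theorem theorem2 {A : Type*} [Fintype A] [DecidableEq A] (hA : 3 ≤ Fintype.card A)
    (σ : Equiv.Perm (Fin 2 × A × Fin 2)) (hσ : Equiv.Perm.sign σ = 1) :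
    HasEvenAlternationDepth σ 13 := by
  obtain ⟨g₁, f₁, g₂, f₂, γ, hg₁, hf₁, hg₂, hf₂, hγ, rfl⟩ := exists_mul_eq_prodCongrRight hA hσ
  obtain ⟨l, hl, hprod, hmem⟩ := hasEvenAlternationDepth_prodCongrRight hA hγ
  refine ⟨twoTimesPerm g₁ :: permTimesTwo f₁ :: twoTimesPerm g₂ :: permTimesTwo f₂ :: l,
    by simp [hl], by simp [hprod, mul_assoc], ?_⟩
  simp only [List.mem_cons]
  rintro τ (rfl | rfl | rfl | rfl | h)
  · exact Or.inr ⟨g₁, hg₁, rfl⟩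
  · exact Or.inl ⟨f₁, hf₁, rfl⟩
  · exact Or.inr ⟨g₂, hg₂, rfl⟩
  · exact Or.inl ⟨f₂, hf₂, rfl⟩
  · exact hmem τ h
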